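/- Let $\mathcal{M}$ be a finite set of indivisible items and let $1 \le n \le 8$. Suppose that there are $n$ agents, and that every agent $i \in \{1,\dots,n\}$ has a valuation function $v_i : 2^{\mathcal{M}} \to \mathbb{R}$ that is normalized ($v_i(\emptyset)=0$), monotone ($v_i(S)\le v_i(T)$ whenever $S\subseteq T\subseteq\mathcal{M}$) and subadditive ($v_i(S\cup T)\le v_i(S)+v_i(T)$ for all $S,T\subseteq\mathcal{M}$). Let $$\mathrm{MMS}(\mathcal{M},v_i,n)=\max_{(P_1,\dots,P_n)}\ \min_{1\le j\le n} v_i(P_j)$$ be the maximin share of agent $i$, where the maximum is over all partitions of $\mathcal{M}$ into $n$ disjoint (possibly empty) bundles. Then there is a $\frac16$-MMS allocation: there are pairwise disjoint sets $A_1,\dots,A_n\subseteq\mathcal{M}$ such that $v_i(A_i)\ge\frac16\,\mathrm{MMS}(\mathcal{M},v_i,n)$ for every agent $i$. -/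

import Mathlib

namespace FairAllocation

/-- A normalized, monotone, subadditive valuation over the finite item set `M`. -/
structure IsSubadditiveValuation {M : Type*} [DecidableEq M] (v : Finset M → ℝ) : Prop where
  normalized : v ∅ = 0
  monotone : ∀ S T : Finset M, S ⊆ T → v S ≤ v T
  subadditive : ∀ S T : Finset M, v (S ∪ T) ≤ v S + v T

/-- An allocation to `n` agents: pairwise disjoint bundles (items may remain unallocated). -/
def IsAllocation {M : Type*} {n : ℕ} (A : Fin n → Finset M) : Prop :=
  ∀ i j : Fin n, i ≠ j → Disjoint (A i) (A j)

/-- A partition of the items into `n` disjoint, possibly empty, bundles. -/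
def IsPartition {M : Type*} {n : ℕ} (P : Fin n → Finset M) : Prop :=
  IsAllocation P ∧ ∀ e : M, ∃ j : Fin n, e ∈ P j

/-- The maximin share: the maximum, over partitions into `n` bundles, of the smallest
bundle value. For `n ≥ 1` the maximum is attained, see `isGreatest_mms`. -/
noncomputable def mms {M : Type*} (v : Finset M → ℝ) (n : ℕ) : ℝ :=
  sSup {r : ℝ | ∃ P : Fin n → Finset M, IsPartition P ∧ r = ⨅ j, v (P j)}

theorem isGreatest_mms {M : Type*} [Fintype M] (v : Finset M → ℝ) (n : ℕ) (hn : 1 ≤ n) :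
    IsGreatest {r : ℝ | ∃ P : Fin n → Finset M, IsPartition P ∧ IsLeast (Set.range (v ∘ P)) r}
      (mms v n) := by
  classical
  have : Nonempty (Fin n) := ⟨⟨0, hn⟩⟩
  have key : ∀ (P : Fin n → Finset M) (r : ℝ),
      IsLeast (Set.range (v ∘ P)) r ↔ r = ⨅ j, v (P j) := by
    intro P r
    have h : IsLeast (Set.range (v ∘ P)) (⨅ j, v (P j)) :=
      ⟨(Set.range_nonempty (v ∘ P)).csInf_mem (Set.finite_range _),
        fun _ hx => csInf_le (Set.finite_range (v ∘ P)).bddBelow hx⟩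
    exact ⟨fun h' => h'.unique h, fun h' => h' ▸ h⟩
  simp only [key]
  have hne : {r : ℝ | ∃ P : Fin n → Finset M, IsPartition P ∧ r = ⨅ j, v (P j)}.Nonempty := by
    refine ⟨_, fun j => if j = ⟨0, hn⟩ then Finset.univ else ∅, ⟨?_, ?_⟩, rfl⟩
    · intro i j hij
      by_cases hi : i = ⟨0, hn⟩
      · have hj : j ≠ ⟨0, hn⟩ := fun h => hij (hi.trans h.symm)
        simp [hj]
      · simp [hi]
    · exact fun e => ⟨⟨0, hn⟩, by simp⟩
  have hfin : {r : ℝ | ∃ P : Fin n → Finset M, IsPartition P ∧ r = ⨅ j, v (P j)}.Finite := by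
    refine (Set.finite_range fun P : Fin n → Finset M => ⨅ j, v (P j)).subset ?_
    rintro r ⟨P, -, rfl⟩
    exact ⟨P, rfl⟩
  exact ⟨hne.csSup_mem hfin, fun _ hx => le_csSup hfin.bddAbove hx⟩

/-- A `ρ`-MMS allocation for agents with valuations `v` and equal entitlements. -/
def IsMMSAllocation {M : Type*} {n : ℕ} (ρ : ℝ) (v : Fin n → Finset M → ℝ)
    (A : Fin n → Finset M) : Prop :=
  IsAllocation A ∧ ∀ i : Fin n, ρ * mms (v i) n ≤ v i (A i)

end FairAllocation

namespace FairAllocation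

/-! Scale each positive maximin share to six, so that an agent has `n` disjoint bundles of value at
least six and wants value one. Call `k` agents solvable at `c` if `k` bundles of value `c` each
always suffice. Solvability is additive (`Solvable.add`): `a` agents at `c` and `b` at `d` give `a +
b` at `c + d`. One agent is solvable at one, so `k` agents are solvable at `k`; alone this reaches
only six agents. The gain is `solvable_four`: four agents are solvable at three instead of four.
Hence seven and eight agents, as 4 + 3 and 4 + 4, are solvable at six. -/

section Bundles

variable {M ι κ : Type*}

/-- The items of `X` can be allocated so that every agent of `I` gets value at least one. -/
def Satisfiable (v : ι → Finset M → ℝ) (I : Finset ι) (X : Finset M) : Prop :=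
  ∃ A : ι → Finset M, (∀ i ∈ I, A i ⊆ X ∧ 1 ≤ v i (A i)) ∧
    ∀ i ∈ I, ∀ j ∈ I, i ≠ j → Disjoint (A i) (A j)

theorem satisfiable_singleton {v : ι → Finset M → ℝ} {i : ι} {X : Finset M} (h : 1 ≤ v i X) :
    Satisfiable v {i} X := by
  refine ⟨fun _ => X, fun j hj => ?_, fun j hj k hk hjk => ?_⟩
  · rw [Finset.mem_singleton.1 hj]
    exact ⟨Finset.Subset.refl X, h⟩
  · exact absurd ((Finset.mem_singleton.1 hj).trans (Finset.mem_singleton.1 hk).symm) hjk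

variable [DecidableEq M] [Fintype κ]

theorem IsSubadditiveValuation.le_add_of_subset_union {v : Finset M → ℝ}
    (hv : IsSubadditiveValuation v) {R S T : Finset M} (h : R ⊆ S ∪ T) : v R ≤ v S + v T :=
  (hv.monotone _ _ h).trans (hv.subadditive S T)

theorem IsSubadditiveValuation.le_add_sdiff {v : Finset M → ℝ}
    (hv : IsSubadditiveValuation v) (R S : Finset M) : v R ≤ v S + v (R \ S) :=
  hv.le_add_of_subset_union (by
    rw [Finset.union_sdiff_self_eq_union]
    exact Finset.subset_union_right)

theorem IsSubadditiveValuation.const_mul {v : Finset M → ℝ} (hv : IsSubadditiveValuation v)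
    {r : ℝ} (hr : 0 ≤ r) : IsSubadditiveValuation fun S => r * v S where
  normalized := by simp [hv.normalized]
  monotone S T h := mul_le_mul_of_nonneg_left (hv.monotone S T h) hr
  subadditive S T := by
    rw [← mul_add]
    exact mul_le_mul_of_nonneg_left (hv.subadditive S T) hr

/-- The number of bundles of the family `p` whose part inside `X` has value at least `c`. -/
noncomputable def bundleCount (v : Finset M → ℝ) (p : κ → Finset M) (X : Finset M) (c : ℝ) : ℕ :=
  (Finset.univ.filter fun j => c ≤ v (p j ∩ X)).card

theorem Satisfiable.union [DecidableEq ι] {v : ι → Finset M → ℝ} {I J : Finset ι} {X Y : Finset M}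
    (hXY : Disjoint X Y) (hI : Satisfiable v I X) (hJ : Satisfiable v J Y) :
    Satisfiable v (I ∪ J) (X ∪ Y) := by
  obtain ⟨A, hA, hA'⟩ := hI
  obtain ⟨B, hB, hB'⟩ := hJ
  refine ⟨fun i => if i ∈ I then A i else B i, fun i hi => ?_, fun i hi j hj hij => ?_⟩
  · by_cases h : i ∈ I
    · simp only [h, if_true]
      exact ⟨(hA i h).1.trans Finset.subset_union_left, (hA i h).2⟩
    · have h' : i ∈ J := (Finset.mem_union.1 hi).resolve_left h
      simp only [h, if_false]
      exact ⟨(hB i h').1.trans Finset.subset_union_right, (hB i h').2⟩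
  · have h1 := Finset.mem_union.1 hi
    have h2 := Finset.mem_union.1 hj
    by_cases h : i ∈ I <;> by_cases h' : j ∈ I <;> simp only [h, h', if_true, if_false]
    · exact hA' i h j h' hij
    · exact Finset.disjoint_of_subset_left (hA i h).1
        (Finset.disjoint_of_subset_right (hB j (h2.resolve_left h')).1 hXY)
    · exact Finset.disjoint_of_subset_left (hB i (h1.resolve_left h)).1
        (Finset.disjoint_of_subset_right (hA j h').1 hXY.symm)
    · exact hB' i (h1.resolve_left h) j (h2.resolve_left h') hij

theorem Satisfiable.of_erase [DecidableEq ι] {v : ι → Finset M → ℝ} {I : Finset ι} {X S : Finset M} {i : ι}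
    (hi : i ∈ I) (hS : S ⊆ X) (h : 1 ≤ v i S) (hI : Satisfiable v (I.erase i) (X \ S)) :
    Satisfiable v I X := by
  have := (satisfiable_singleton h).union Finset.disjoint_sdiff hI
  rwa [Finset.union_sdiff_of_subset hS, ← Finset.insert_eq, Finset.insert_erase hi] at this

/-! ### How bundle counts change when items are removed -/

theorem exists_le_of_bundleCount_pos {v : Finset M → ℝ} {p : κ → Finset M} {X : Finset M} {c : ℝ}
    (h : 0 < bundleCount v p X c) : ∃ j, c ≤ v (p j ∩ X) := by
  obtain ⟨j, hj⟩ := Finset.card_pos.1 h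
  exact ⟨j, (Finset.mem_filter.1 hj).2⟩

theorem le_of_bundleCount_pos {v : Finset M → ℝ} (hv : IsSubadditiveValuation v)
    {p : κ → Finset M} {X : Finset M} {c : ℝ} (h : 0 < bundleCount v p X c) : c ≤ v X := by
  obtain ⟨j, hj⟩ := exists_le_of_bundleCount_pos h
  exact hj.trans (hv.monotone _ _ Finset.inter_subset_right)

theorem bundleCount_mono {v : Finset M → ℝ} (p : κ → Finset M) {X : Finset M} {c d : ℝ}
    (h : d ≤ c) : bundleCount v p X c ≤ bundleCount v p X d :=
  Finset.card_le_card fun j hj => by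
    simp only [Finset.mem_filter, Finset.mem_univ, true_and] at hj ⊢
    exact h.trans hj

theorem bundleCount_mono_set {v : Finset M → ℝ} (hv : IsSubadditiveValuation v)
    (p : κ → Finset M) {X Y : Finset M} (h : X ⊆ Y) (c : ℝ) :
    bundleCount v p X c ≤ bundleCount v p Y c :=
  Finset.card_le_card fun j hj => by
    simp only [Finset.mem_filter, Finset.mem_univ, true_and] at hj ⊢
    exact hj.trans (hv.monotone _ _ (Finset.inter_subset_inter_left h))

/-- A set that is worth at most `d` after the removal of one item spoils only one bundle by
more than `d`. -/
theorem bundleCount_le_sdiff {v : Finset M → ℝ} (hv : IsSubadditiveValuation v)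
    {p : κ → Finset M} (hp : ∀ i j, i ≠ j → Disjoint (p i) (p j)) {X S : Finset M} {e : M}
    {d : ℝ} (h : v (S.erase e) ≤ d) (c : ℝ) :
    bundleCount v p X c ≤ bundleCount v p (X \ S) (c - d) + 1 := by
  classical
  have hcard : (Finset.univ.filter fun j => e ∈ p j).card ≤ 1 := by
    refine Finset.card_le_one.2 fun i hi j hj => ?_
    by_contra hij
    exact Finset.disjoint_left.1 (hp i j hij) (Finset.mem_filter.1 hi).2 (Finset.mem_filter.1 hj).2
  refine le_trans (Finset.card_le_card (t := (Finset.univ.filter fun j => c - d ≤ v (p j ∩ (X \ S)))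
    ∪ Finset.univ.filter fun j => e ∈ p j) fun j hj => ?_)
    ((Finset.card_union_le _ _).trans (Nat.add_le_add_left hcard _))
  simp only [Finset.mem_union, Finset.mem_filter, Finset.mem_univ, true_and] at hj ⊢
  by_cases he : e ∈ p j
  · exact Or.inr he
  · left
    have : p j ∩ X ⊆ (p j ∩ (X \ S)) ∪ S.erase e := fun x hx => by
      have hxe : x ≠ e := fun h => he (h ▸ (Finset.mem_inter.1 hx).1)
      simp only [Finset.mem_union, Finset.mem_inter, Finset.mem_sdiff, Finset.mem_erase] at hx ⊢
      tauto
    linarith [hv.le_add_of_subset_union this]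

/-- By subadditivity, a bundle worth `c + d` in `X` is worth `d` inside `Y` or `c` outside it. -/
theorem bundleCount_add_le {v : Finset M → ℝ} (hv : IsSubadditiveValuation v)
    (p : κ → Finset M) (X Y : Finset M) (c d : ℝ) :
    bundleCount v p X (c + d) ≤ bundleCount v p Y d + bundleCount v p (X \ Y) c := by
  classical
  refine le_trans (Finset.card_le_card fun j hj => ?_) (Finset.card_union_le _ _)
  simp only [Finset.mem_union, Finset.mem_filter, Finset.mem_univ, true_and] at hj ⊢
  by_contra! h
  have : p j ∩ X ⊆ (p j ∩ Y) ∪ (p j ∩ (X \ Y)) := fun x hx => by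
    simp only [Finset.mem_union, Finset.mem_inter, Finset.mem_sdiff] at hx ⊢
    tauto
  linarith [hv.le_add_of_subset_union this]

/-! ### Solvability and its additivity -/

/-- Any `k` agents that have at least `k` bundles of value `c` inside `X` can be satisfied
with items of `X`. -/
def Solvable (v : ι → Finset M → ℝ) (p : ι → κ → Finset M) (k : ℕ) (c : ℝ) : Prop :=
  ∀ (I : Finset ι) (X : Finset M), I.card = k → (∀ i ∈ I, k ≤ bundleCount (v i) (p i) X c) →
    Satisfiable v I X

theorem Solvable.mono {v : ι → Finset M → ℝ} {p : ι → κ → Finset M} {k : ℕ} {c d : ℝ}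
    (h : Solvable v p k c) (hcd : c ≤ d) : Solvable v p k d :=
  fun I X hI hX => h I X hI fun i hi => (hX i hi).trans (bundleCount_mono (p i) hcd)

theorem solvable_zero (v : ι → Finset M → ℝ) (p : ι → κ → Finset M) (c : ℝ) :
    Solvable v p 0 c := by
  intro I X hI _
  rw [Finset.card_eq_zero] at hI
  subst hI
  exact ⟨fun _ => ∅, by simp, by simp⟩

theorem solvable_one {v : ι → Finset M → ℝ} (hv : ∀ i, IsSubadditiveValuation (v i))
    (p : ι → κ → Finset M) : Solvable v p 1 1 := by
  intro I X hI hX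
  obtain ⟨i, rfl⟩ := Finset.card_eq_one.1 hI
  exact satisfiable_singleton
    (le_of_bundleCount_pos (hv i) (hX i (Finset.mem_singleton_self i)))

variable {v : ι → Finset M → ℝ} {p : ι → κ → Finset M}

/-- Items are moved one by one to a part `Y` until `b` agents accept it; the other agents then
still accept the complement. -/
theorem Solvable.add (hv : ∀ i, IsSubadditiveValuation (v i))
    (hp : ∀ i j k, j ≠ k → Disjoint (p i j) (p i k)) {a b : ℕ} (hb : 1 ≤ b) {c d : ℝ}
    (hc : 0 < c) (hd : 0 < d) (ha : Solvable v p a c) (hb' : Solvable v p b d) :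
    Solvable v p (a + b) (c + d) := by
  classical
  intro I X hI hX
  let T : Finset M → Finset ι := fun Y => I.filter fun i => b ≤ bundleCount (v i) (p i) Y d
  have hTX : b ≤ (T X).card := by
    have : T X = I := Finset.filter_true_of_mem fun i hi =>
      (Nat.le_add_left b a).trans ((hX i hi).trans (bundleCount_mono (p i) (by linarith)))
    rw [this, hI]
    exact Nat.le_add_left b a
  obtain ⟨Y, hY, hmin⟩ := Finset.exists_min_image (X.powerset.filter fun Y => b ≤ (T Y).card)
    Finset.card ⟨X, by simp [hTX]⟩
  simp only [Finset.mem_filter, Finset.mem_powerset] at hY hmin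
  obtain ⟨hYX, hYb⟩ := hY
  have hYne : Y.Nonempty := by
    rw [Finset.nonempty_iff_ne_empty]
    rintro rfl
    obtain ⟨i, hi⟩ := Finset.card_pos.1 (Nat.lt_of_lt_of_le hb hYb)
    have h := le_of_bundleCount_pos (hv i) (Nat.lt_of_lt_of_le hb (Finset.mem_filter.1 hi).2)
    rw [(hv i).normalized] at h
    linarith
  obtain ⟨e, he⟩ := hYne
  have hlt : (T (Y.erase e)).card < b := by
    by_contra! h
    have := hmin (Y.erase e) ⟨(Finset.erase_subset e Y).trans hYX, h⟩
    exact absurd (Finset.card_erase_lt_of_mem he) (not_lt.2 this)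
  have hsub : T (Y.erase e) ⊆ T Y := fun i hi => by
    simp only [T, Finset.mem_filter] at hi ⊢
    exact ⟨hi.1, hi.2.trans (bundleCount_mono_set (hv i) (p i) (Finset.erase_subset e Y) d)⟩
  -- `J` contains everyone who accepted before `e` arrived, so each agent outside `J` rejects
  -- `Y.erase e`.
  obtain ⟨J, hJ1, hJ2, hJ⟩ := Finset.exists_subsuperset_card_eq hsub hlt.le hYb
  have hJI : J ⊆ I := hJ2.trans (Finset.filter_subset _ _)
  have h1 : Satisfiable v J Y := hb' J Y hJ fun i hi => (Finset.mem_filter.1 (hJ2 hi)).2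
  have h2 : Satisfiable v (I \ J) (X \ Y) := by
    refine ha _ _ (by rw [Finset.card_sdiff_of_subset hJI]; omega) fun i hi => ?_
    obtain ⟨hiI, hiJ⟩ := Finset.mem_sdiff.1 hi
    have hn : bundleCount (v i) (p i) (Y.erase e) d < b := by
      by_contra! h
      exact hiJ (hJ1 (Finset.mem_filter.2 ⟨hiI, h⟩))
    -- At most `b - 1` bundles are lost to `Y.erase e`, leaving `a + 1` at level `c`. Removing `e`
    -- as well harms only the bundle containing it, which leaves `a`.
    have h3 := bundleCount_add_le (hv i) (p i) X (Y.erase e) c d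
    have h4 : bundleCount (v i) (p i) (X \ Y.erase e) c
        ≤ bundleCount (v i) (p i) ((X \ Y.erase e) \ {e}) (c - 0) + 1 :=
      bundleCount_le_sdiff (hv i) (hp i) (e := e) (by simp [(hv i).normalized]) c
    have h5 : (X \ Y.erase e) \ {e} = X \ Y := by
      ext x
      simp only [Finset.mem_sdiff, Finset.mem_erase, Finset.mem_singleton]
      constructor
      · tauto
      · rintro ⟨hx, hxY⟩
        exact ⟨⟨hx, fun h => hxY h.2⟩, fun h => hxY (h ▸ he)⟩
    rw [h5, sub_zero] at h4
    have := hX i hiI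
    omega
  have := h1.union Finset.disjoint_sdiff h2
  rwa [Finset.union_sdiff_of_subset hYX, Finset.union_sdiff_of_subset hJI] at this

/-! ### Four agents at value three -/

/-- Give a minimal acceptable set to an agent who accepts it. -/
theorem exists_bundleCount_le_sdiff (hv : ∀ i, IsSubadditiveValuation (v i))
    (hp : ∀ i j k, j ≠ k → Disjoint (p i j) (p i k)) {I : Finset ι} {Y : Finset M}
    (hY : ∃ i ∈ I, 1 ≤ v i Y) :
    ∃ S ⊆ Y, ∃ i ∈ I, 1 ≤ v i S ∧ ∀ j ∈ I, ∀ (X : Finset M) (c : ℝ),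
      bundleCount (v j) (p j) X c ≤ bundleCount (v j) (p j) (X \ S) (c - 1) + 1 := by
  classical
  obtain ⟨S, hS, hmin⟩ := Finset.exists_min_image
    (Y.powerset.filter fun S => ∃ i ∈ I, 1 ≤ v i S) Finset.card ⟨Y, by simpa using hY⟩
  simp only [Finset.mem_filter, Finset.mem_powerset] at hS hmin
  obtain ⟨hSY, i, hi, hiS⟩ := hS
  have hne : S.Nonempty := by
    rw [Finset.nonempty_iff_ne_empty]
    rintro rfl
    rw [(hv i).normalized] at hiS
    linarith
  obtain ⟨e, he⟩ := hne
  refine ⟨S, hSY, i, hi, hiS, fun j hj X c => bundleCount_le_sdiff (hv j) (hp j) (e := e) ?_ c⟩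
  by_contra! h
  have := hmin (S.erase e) ⟨(Finset.erase_subset e S).trans hSY, j, hj, h.le⟩
  exact absurd (Finset.card_erase_lt_of_mem he) (not_lt.2 this)

/-- Cut and choose: one agent cuts `X` into two acceptable parts, the other one takes a part. -/
theorem satisfiable_pair [DecidableEq ι] (hv : ∀ i, IsSubadditiveValuation (v i))
    (hp : ∀ i j k, j ≠ k → Disjoint (p i j) (p i k)) {a b : ι} (hab : a ≠ b) {X : Finset M}
    (ha : 2 ≤ v a X) (hb : 2 ≤ bundleCount (v b) (p b) X 1) : Satisfiable v {a, b} X := by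
  obtain ⟨j, hj, k, hk, hjk⟩ := Finset.one_lt_card.1 hb
  simp only [Finset.mem_filter, Finset.mem_univ, true_and] at hj hk
  have hk' : 1 ≤ v b (X \ (p b j ∩ X)) := hk.trans <| (hv b).monotone _ _ fun x hx => by
    have := Finset.disjoint_right.1 (hp b j k hjk) (Finset.mem_inter.1 hx).1
    simp only [Finset.mem_sdiff, Finset.mem_inter] at hx ⊢
    tauto
  have he : ({a, b} : Finset ι).erase a = {b} := by
    ext x
    simp only [Finset.mem_erase, Finset.mem_insert, Finset.mem_singleton]
    constructor
    · tauto
    · rintro rfl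
      exact ⟨hab.symm, Or.inr rfl⟩
  rcases le_or_gt 1 (v a (p b j ∩ X)) with h | h
  · refine Satisfiable.of_erase (i := a) (by simp) Finset.inter_subset_right h ?_
    rw [he]
    exact satisfiable_singleton hk'
  · have h' := (hv a).le_add_sdiff X (p b j ∩ X)
    refine Satisfiable.of_erase (i := a) (S := X \ (p b j ∩ X)) (by simp) Finset.sdiff_subset
      (by linarith) ?_
    rw [he, Finset.sdiff_sdiff_eq_self Finset.inter_subset_right]
    exact satisfiable_singleton hj

/-- Two agents get minimal sets that avoid one bundle of a fixed agent `a`. Then `a` still has value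
three, while the last agent goes from four bundles at three to three at two to two at one. These two
finish by cut and choose, which asks only value two of `a`. -/
theorem solvable_four (hv : ∀ i, IsSubadditiveValuation (v i))
    (hp : ∀ i j k, j ≠ k → Disjoint (p i j) (p i k)) : Solvable v p 4 3 := by
  classical
  intro I X hI hX
  obtain ⟨a, haI⟩ : I.Nonempty := Finset.card_pos.1 (by omega)
  set J := Finset.univ.filter fun j => 3 ≤ v a (p a j ∩ X)
  have hJ : 4 ≤ J.card := hX a haI
  have hI' : (I.erase a).card = 3 := by rw [Finset.card_erase_of_mem haI, hI]
  have hXI : ∀ i ∈ I.erase a, 4 ≤ bundleCount (v i) (p i) X 3 :=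
    fun i hi => hX i (Finset.mem_of_mem_erase hi)
  -- It is enough to serve two agents without touching one of the bundles of `a`.
  obtain ⟨S, hSX, d, hd, hdS, hS, j, hjJ, hSj, hnext⟩ : ∃ S ⊆ X, ∃ d ∈ I.erase a, 1 ≤ v d S ∧
      (∀ i ∈ I.erase a, ∀ (Y : Finset M) (c : ℝ),
        bundleCount (v i) (p i) Y c ≤ bundleCount (v i) (p i) (Y \ S) (c - 1) + 1) ∧
      ∃ j ∈ J, Disjoint S (p a j ∩ X) ∧
        ∃ i ∈ (I.erase a).erase d, 1 ≤ v i ((X \ S) \ (p a j ∩ X)) := by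
    have hrest : ∀ (S : Finset M) (d : ι), d ∈ I.erase a →
        (∀ i ∈ I.erase a, ∀ (Y : Finset M) (c : ℝ),
          bundleCount (v i) (p i) Y c ≤ bundleCount (v i) (p i) (Y \ S) (c - 1) + 1) →
        ∀ j, (∀ i ∈ (I.erase a).erase d, v i (p a j ∩ X) < 1) →
        ∃ i ∈ (I.erase a).erase d, 1 ≤ v i ((X \ S) \ (p a j ∩ X)) := by
      intro S d hd hS j hj
      obtain ⟨i, hi⟩ : ((I.erase a).erase d).Nonempty :=
        Finset.card_pos.1 (by rw [Finset.card_erase_of_mem hd]; omega)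
      have hi' := Finset.mem_of_mem_erase hi
      have h1 := hS i hi' X 3
      have h2 := hXI i hi'
      have h3 : (3 : ℝ) - 1 ≤ v i (X \ S) :=
        le_of_bundleCount_pos (hv i) (p := p i) (by omega)
      have h4 := (hv i).le_add_sdiff (X \ S) (p a j ∩ X)
      exact ⟨i, hi, by linarith [hj i hi]⟩
    -- If another agent wants a bundle of `a`, the first set is cut from it, and the other bundles
    -- of `a` stay intact.
    by_cases hcase : ∃ j ∈ J, ∃ i ∈ I.erase a, 1 ≤ v i (p a j ∩ X)
    · obtain ⟨j₁, hj₁, hwin⟩ := hcase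
      obtain ⟨S, hSY, d, hd, hdS, hS⟩ := exists_bundleCount_le_sdiff hv hp hwin
      have hdisj : ∀ j, j ≠ j₁ → Disjoint S (p a j ∩ X) := fun j hj =>
        Finset.disjoint_of_subset_left (hSY.trans Finset.inter_subset_left)
          (Finset.disjoint_of_subset_right Finset.inter_subset_left (hp a j₁ j hj.symm))
      refine ⟨S, hSY.trans Finset.inter_subset_right, d, hd, hdS, hS, ?_⟩
      -- A second wanted bundle serves the next agent and a third is reserved for `a`. If no other
      -- bundle is wanted, reserving one costs each remaining agent less than one of the value two
      -- left.
      by_cases hcase' : ∃ j ∈ J.erase j₁, ∃ i ∈ (I.erase a).erase d, 1 ≤ v i (p a j ∩ X)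
      · obtain ⟨j₂, hj₂, i, hi, hi'⟩ := hcase'
        obtain ⟨j, hj⟩ : ((J.erase j₁).erase j₂).Nonempty := Finset.card_pos.1 (by
          rw [Finset.card_erase_of_mem hj₂, Finset.card_erase_of_mem hj₁]; omega)
        have hjj₂ := Finset.ne_of_mem_erase hj
        have hj' := Finset.mem_of_mem_erase hj
        refine ⟨j, Finset.mem_of_mem_erase hj', hdisj j (Finset.ne_of_mem_erase hj'), i, hi,
          hi'.trans ((hv i).monotone _ _ fun x hx => ?_)⟩
        have h1 := Finset.disjoint_right.1 (hdisj j₂ (Finset.ne_of_mem_erase hj₂)) hx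
        have h2 := Finset.disjoint_right.1 (hp a j j₂ hjj₂) (Finset.mem_inter.1 hx).1
        simp only [Finset.mem_sdiff, Finset.mem_inter] at hx ⊢
        tauto
      · push Not at hcase'
        obtain ⟨j, hj⟩ : (J.erase j₁).Nonempty := Finset.card_pos.1 (by
          rw [Finset.card_erase_of_mem hj₁]; omega)
        exact ⟨j, Finset.mem_of_mem_erase hj, hdisj j (Finset.ne_of_mem_erase hj),
          hrest S d hd hS j (hcase' j hj)⟩
    -- No bundle of `a` is wanted, so any one can be reserved at a cost below one to everyone else.
    · push Not at hcase
      obtain ⟨j, hj⟩ : J.Nonempty := Finset.card_pos.1 (by omega)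
      obtain ⟨b, hb⟩ : (I.erase a).Nonempty := Finset.card_pos.1 (by omega)
      have hwin : 1 ≤ v b (X \ (p a j ∩ X)) := by
        have h1 := le_of_bundleCount_pos (hv b) (Nat.lt_of_lt_of_le (by omega) (hXI b hb))
        have h2 := (hv b).le_add_sdiff X (p a j ∩ X)
        linarith [hcase j hj b hb]
      obtain ⟨S, hSY, d, hd, hdS, hS⟩ := exists_bundleCount_le_sdiff hv hp ⟨b, hb, hwin⟩
      exact ⟨S, hSY.trans Finset.sdiff_subset, d, hd, hdS, hS, j, hj,
        Finset.disjoint_of_subset_left hSY Finset.sdiff_disjoint,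
        hrest S d hd hS j fun i hi => hcase j hj i (Finset.mem_of_mem_erase hi)⟩
  obtain ⟨S', hS'Y, d', hd', hdS', hS'⟩ := exists_bundleCount_le_sdiff hv hp hnext
  obtain ⟨b, hb⟩ := Finset.card_eq_one.1 (show (((I.erase a).erase d).erase d').card = 1 by
    rw [Finset.card_erase_of_mem hd', Finset.card_erase_of_mem hd, hI'])
  have hb1 : b ∈ (I.erase a).erase d := Finset.mem_of_mem_erase (hb ▸ Finset.mem_singleton_self b)
  have hb2 : b ∈ I.erase a := Finset.mem_of_mem_erase hb1
  have hdI := Finset.mem_of_mem_erase hd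
  have hd'1 := Finset.mem_of_mem_erase hd'
  refine Satisfiable.of_erase hdI hSX hdS (Satisfiable.of_erase (i := d')
    (Finset.mem_erase.2 ⟨Finset.ne_of_mem_erase hd', Finset.mem_of_mem_erase hd'1⟩)
    (hS'Y.trans Finset.sdiff_subset) hdS' ?_)
  have hpair : (I.erase d).erase d' = {a, b} := by
    have h1 : a ∈ (I.erase d).erase d' := Finset.mem_erase.2
      ⟨(Finset.ne_of_mem_erase hd'1).symm, Finset.mem_erase.2
        ⟨(Finset.ne_of_mem_erase hd).symm, haI⟩⟩
    rw [← Finset.insert_erase h1, Finset.erase_right_comm, Finset.erase_right_comm (a := d), hb]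
  rw [hpair]
  refine satisfiable_pair hv hp (Finset.ne_of_mem_erase hb2).symm ?_ ?_
  · have h1 : p a j ∩ X ⊆ (X \ S) \ S' := fun x hx => by
      have h2 := Finset.disjoint_right.1 hSj hx
      have h3 : x ∉ S' := fun h => (Finset.mem_sdiff.1 (hS'Y h)).2 hx
      exact Finset.mem_sdiff.2
        ⟨Finset.mem_sdiff.2 ⟨(Finset.mem_inter.1 hx).2, h2⟩, h3⟩
    linarith [(hv a).monotone _ _ h1, (Finset.mem_filter.1 hjJ).2]
  · have h1 := hXI b hb2
    have h2 := hS b hb2 X 3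
    have h3 := hS' b hb1 (X \ S) (3 - 1)
    norm_num at h2 h3
    omega

/-- Five is 3 + 2 and six is 3 + 3; the block of four is needed for seven and eight. -/
theorem solvable_six_of_le_eight (hv : ∀ i, IsSubadditiveValuation (v i))
    (hp : ∀ i j k, j ≠ k → Disjoint (p i j) (p i k)) {k : ℕ} (hk : k ≤ 8) :
    Solvable v p k 6 := by
  have h1 := solvable_one hv p
  have h2 := h1.add hv hp le_rfl one_pos one_pos h1
  have h3 := h2.add hv hp le_rfl (by norm_num) one_pos h1
  have h4 := solvable_four hv hp
  interval_cases k
  · exact solvable_zero v p 6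
  · exact h1.mono (by norm_num)
  · exact h2.mono (by norm_num)
  · exact h3.mono (by norm_num)
  · exact h4.mono (by norm_num)
  · exact (h3.add hv hp (by norm_num) (by norm_num) (by norm_num) h2).mono (by norm_num)
  · exact (h3.add hv hp (by norm_num) (by norm_num) (by norm_num) h3).mono (by norm_num)
  · exact (h4.add hv hp (by norm_num) (by norm_num) (by norm_num) h3).mono (by norm_num)
  · exact (h4.add hv hp (by norm_num) (by norm_num) (by norm_num) h4).mono (by norm_num)

end Bundles

end FairAllocation

/-! ### Rescaling to maximin shares -/

open FairAllocation in
theorem mainTheorem6 {M : Type*} [Fintype M] [DecidableEq M] (n : ℕ) (hn : n ≤ 8)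
    (v : Fin n → Finset M → ℝ)
    (hv : ∀ i : Fin n, FairAllocation.IsSubadditiveValuation (v i)) :
    ∃ A : Fin n → Finset M, FairAllocation.IsMMSAllocation (1 / 6) v A := by
  have hex : ∀ i : Fin n, ∃ P : Fin n → Finset M, IsPartition P ∧ ∀ j, mms (v i) n ≤ v i (P j) := by
    intro i
    obtain ⟨P, hP, hmin⟩ := (isGreatest_mms (v i) n i.pos).1
    exact ⟨P, hP, fun j => hmin.2 ⟨j, rfl⟩⟩
  choose P hP hPv using hex
  -- Agents with maximin share zero accept the empty bundle; the others are normalized to six.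
  let I : Finset (Fin n) := Finset.univ.filter fun i => 0 < mms (v i) n
  -- The maximum with zero keeps the factor nonnegative for every agent; on `I` it changes nothing.
  let w : Fin n → Finset M → ℝ := fun i S => max 0 (6 / mms (v i) n) * v i S
  have hw : ∀ i, IsSubadditiveValuation (w i) := fun i => (hv i).const_mul (le_max_left _ _)
  have hwI : ∀ i ∈ I, ∀ S, w i S = 6 / mms (v i) n * v i S := fun i hi S => by
    have : 0 < mms (v i) n := (Finset.mem_filter.1 hi).2
    simp only [w, max_eq_right (by positivity : 0 ≤ 6 / mms (v i) n)]
  have hcard : I.card ≤ n := (Finset.card_le_univ I).trans (Fintype.card_fin n).le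
  obtain ⟨A, hA, hdisj⟩ := solvable_six_of_le_eight hw (fun i => (hP i).1) (hcard.trans hn)
    I Finset.univ rfl fun i hi => by
      have hpos : 0 < mms (v i) n := (Finset.mem_filter.1 hi).2
      have : bundleCount (w i) (P i) Finset.univ 6 = n := by
        unfold bundleCount
        rw [Finset.filter_true_of_mem, Finset.card_univ, Fintype.card_fin]
        intro j _
        rw [Finset.inter_univ, hwI i hi, div_mul_eq_mul_div, le_div_iff₀ hpos]
        exact mul_le_mul_of_nonneg_left (hPv i j) (by norm_num)
      -- All `n` bundles remain available to the possibly fewer agents of `I`.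
      exact hcard.trans this.ge
  refine ⟨fun i => if i ∈ I then A i else ∅, fun i j hij => ?_, fun i => ?_⟩
  · by_cases hi : i ∈ I <;> by_cases hj : j ∈ I <;> simp only [hi, hj, if_true, if_false]
    · exact hdisj i hi j hj hij
    · exact Finset.disjoint_empty_right _
    · exact Finset.disjoint_empty_left _
    · exact Finset.disjoint_empty_left _
  · by_cases hi : i ∈ I
    · have hpos : 0 < mms (v i) n := (Finset.mem_filter.1 hi).2
      have h := (hA i hi).2
      rw [hwI i hi, div_mul_eq_mul_div, le_div_iff₀ hpos] at h
      simp only [hi, if_true]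
      linarith
    · have : mms (v i) n ≤ 0 := not_lt.1 fun h => hi (Finset.mem_filter.2 ⟨Finset.mem_univ i, h⟩)
      simp only [hi, if_false, (hv i).normalized]
      linarith
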